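/- Let $n \ge 1$, let $\mathbb{D}^n = \{z \in \mathbb{C}^n : |z_i| < 1 \text{ for all } i\}$, and let $\mathcal{H}_k$ be the scalar-valued Hardy, Bergman or Dirichlet space on $\mathbb{D}^n$, that is, the reproducing kernel Hilbert space of functions on $\mathbb{D}^n$ with kernel $$k(z,w) = \prod_{i=1}^n \tilde{k}(z_i, w_i) \qquad (z, w \in \mathbb{D}^n),$$ where, respectively, $\tilde{k}(z,w) = (1 - z\bar{w})^{-1}$, $\tilde{k}(z,w) = (1 - z\bar{w})^{-2}$, or $\tilde{k}(z,w) = \frac{1}{z\bar{w}} \log\frac{1}{1 - z\bar{w}}$ (with value $1$ where $z\bar{w} = 0$). Let $\varphi : \mathbb{D}^n \to \mathbb{C}$ be a contractive multiplier of $\mathcal{H}_k$, that is, $\varphi f \in \mathcal{H}_k$ for every $f \in \mathcal{H}_k$, and the (automatically bounded) multiplication operator $M_\varphi f = \varphi f$ on $\mathcal{H}_k$ satisfies $\|M_\varphi\| \le 1$. Then the following are equivalent: (i) $M_\varphi$ is a pure contraction, that is, $\|M_\varphi\| \le 1$ and $\|M_\varphi^{*m} h\| \to 0$ as $m \to \infty$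 for every $h \in \mathcal{H}_k$; (ii) $|\varphi(0)| < 1$. -/

import Mathlib

open scoped ComplexOrder ComplexConjugate Topology

/-- The open unit polydisc in `ℂⁿ`. -/
def polydisc (n : ℕ) : Set (Fin n → ℂ) := {z | ∀ i, ‖z i‖ < 1}

/-- The origin, as a point of the polydisc. -/
def polydiscZero (n : ℕ) : polydisc n := ⟨0, fun i => by simp⟩

/-- The three classical families of function spaces on the polydisc. -/
inductive ClassicalSpace
  | hardy
  | bergman
  | dirichlet

/-- The function `F` with `k̃(z, w) = F (z * conj w)`, where `k̃` is the reproducing kernel of the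
space on the unit disc: `(1 - t)⁻¹` for Hardy (Szegő kernel), `(1 - t)⁻²` for Bergman, and
`t⁻¹ log (1 / (1 - t))` for Dirichlet, the latter with its removable singularity at `0` filled. -/
noncomputable def discKernelFun : ClassicalSpace → ℂ → ℂ
  | .hardy, t => (1 - t)⁻¹
  | .bergman, t => ((1 - t) ^ 2)⁻¹
  | .dirichlet, t => if t = 0 then 1 else t⁻¹ * Complex.log ((1 - t)⁻¹)

/-- The product kernel `k(z, w) = ∏ᵢ k̃(zᵢ, wᵢ)` on the polydisc. -/
noncomputable def polydiscKernel (S : ClassicalSpace) (n : ℕ) :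
    Matrix (polydisc n) (polydisc n) ℂ :=
  Matrix.of fun z w => ∏ i : Fin n, discKernelFun S ((z : Fin n → ℂ) i * conj ((w : Fin n → ℂ) i))

/-- The scalar kernel `k`, with its values regarded as operators on `ℂ`. -/
noncomputable def polydiscKernelOp (S : ClassicalSpace) (n : ℕ) :
    Matrix (polydisc n) (polydisc n) (ℂ →L[ℂ] ℂ) :=
  Matrix.of fun z w => polydiscKernel S n z w • ContinuousLinearMap.id ℂ ℂ

/-! Positive semidefiniteness of the kernels, so that the reproducing kernel spaces exist. -/

/-- The Taylor coefficients of `discKernelFun`. -/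
noncomputable def discCoeff : ClassicalSpace → ℕ → ℝ
  | .hardy, _ => 1
  | .bergman, k => k + 1
  | .dirichlet, k => 1 / (k + 1)

theorem discCoeff_nonneg (S : ClassicalSpace) (k : ℕ) : 0 ≤ discCoeff S k := by
  cases S <;> simp only [discCoeff] <;> positivity

theorem hasSum_discKernelFun (S : ClassicalSpace) {t : ℂ} (ht : ‖t‖ < 1) :
    HasSum (fun k => (discCoeff S k : ℂ) * t ^ k) (discKernelFun S t) := by
  cases S with
  | hardy => simpa [discCoeff, discKernelFun] using hasSum_geometric_of_norm_lt_one ht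
  | bergman =>
    simpa [discCoeff, discKernelFun] using hasSum_choose_mul_geometric_of_norm_lt_one 1 ht
  | dirichlet =>
    simp only [discCoeff, discKernelFun]
    split_ifs with h0
    · subst h0
      convert! hasSum_single (f := fun k : ℕ => (((1 / ((k : ℝ) + 1) : ℝ)) : ℂ) * (0 : ℂ) ^ k)
        0 (fun k hk => by simp [hk]) using 1
      simp
    · have h1 := Complex.hasSum_taylorSeries_neg_log ht
      rw [← hasSum_nat_add_iff' 1] at h1
      have h2 := h1.mul_left t⁻¹
      have harg : (1 - t).arg ≠ Real.pi := by
        intro h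
        have := (Complex.arg_eq_pi_iff.1 h).1
        have h3 := Complex.re_le_norm t
        simp at this
        linarith
      rw [Complex.log_inv _ harg]
      convert! h2 using 1
      · ext k
        push_cast
        field_simp
        ring
      · simp

theorem posSemidef_discKernel {X : Type*} (S : ClassicalSpace) (g : X → ℂ) (hg : ∀ x, ‖g x‖ < 1) :
    (Matrix.of fun x y => discKernelFun S (g x * conj (g y)) : Matrix X X ℂ).PosSemidef := by
  have hlt : ∀ x y, ‖g x * conj (g y)‖ < 1 := fun x y => by
    rw [norm_mul, RCLike.norm_conj]
    exact mul_lt_one_of_nonneg_of_lt_one_left (norm_nonneg _) (hg x) (hg y).le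
  have hs : ∀ x y, HasSum (fun k => (discCoeff S k : ℂ) * (g x * conj (g y)) ^ k)
      (discKernelFun S (g x * conj (g y))) := fun x y => hasSum_discKernelFun S (hlt x y)
  refine ⟨?_, fun v => ?_⟩
  · ext x y
    simp only [Matrix.conjTranspose_apply, Matrix.of_apply]
    refine HasSum.unique ?_ (hs x y)
    convert! (hs y x).star using 1
    ext k
    simp [mul_comm]
  · simp only [Finsupp.sum, Matrix.of_apply]
    have hsum : HasSum (fun k => ∑ x ∈ v.support, ∑ y ∈ v.support,
        star (v x) * ((discCoeff S k : ℂ) * (g x * conj (g y)) ^ k) * v y)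
        (∑ x ∈ v.support, ∑ y ∈ v.support,
          star (v x) * discKernelFun S (g x * conj (g y)) * v y) :=
      hasSum_sum fun x _ => hasSum_sum fun y _ => ((hs x y).mul_left _).mul_right _
    refine hsum.nonneg fun k => ?_
    have : ∑ x ∈ v.support, ∑ y ∈ v.support,
        star (v x) * ((discCoeff S k : ℂ) * (g x * conj (g y)) ^ k) * v y
        = (discCoeff S k : ℂ) * ((∑ x ∈ v.support, star (v x) * g x ^ k) *
          star (∑ x ∈ v.support, star (v x) * g x ^ k)) := by
      rw [star_sum, Finset.sum_mul_sum, Finset.mul_sum]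
      refine Finset.sum_congr rfl fun x _ => ?_
      rw [Finset.mul_sum]
      refine Finset.sum_congr rfl fun y _ => ?_
      simp
      ring
    rw [this]
    exact mul_nonneg (by exact_mod_cast discCoeff_nonneg S k) (mul_star_self_nonneg _)

theorem posSemidef_polydiscKernel (S : ClassicalSpace) (n : ℕ) :
    (polydiscKernel S n).PosSemidef := by
  have key : ∀ s : Finset (Fin n), (Matrix.of fun z w : polydisc n =>
      ∏ i ∈ s, discKernelFun S ((z : Fin n → ℂ) i * conj ((w : Fin n → ℂ) i))).PosSemidef := by
    intro s
    induction s using Finset.induction_on with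
    | empty =>
      refine ⟨by ext; simp, fun v => ?_⟩
      have : (v.sum fun i xi => v.sum fun j xj => star xi *
          (Matrix.of fun z w : polydisc n => ∏ i ∈ (∅ : Finset (Fin n)),
            discKernelFun S ((z : Fin n → ℂ) i * conj ((w : Fin n → ℂ) i))) i j * xj)
          = star (v.sum fun _ x => x) * (v.sum fun _ x => x) := by
        simp [Finsupp.sum, Finset.sum_mul_sum]
      rw [this]
      exact star_mul_self_nonneg _
    | insert a s ha ih =>
      have h := (posSemidef_discKernel S (fun z : polydisc n => (z : Fin n → ℂ) a)
        (fun z => z.2 a)).hadamard ih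
      convert! h using 1
      ext z w
      simp [Finset.prod_insert ha]
  exact key Finset.univ

theorem posSemidef_polydiscKernelOp (S : ClassicalSpace) (n : ℕ) :
    (polydiscKernelOp S n).PosSemidef := by
  have hk := posSemidef_polydiscKernel S n
  have htfae := RKHS.posSemidef_tfae (K := polydiscKernelOp S n)
  apply (htfae.out 0 2 rfl rfl).mpr
  refine ⟨?_, fun v => ?_⟩
  · ext z w
    have := hk.1.apply z w
    simp only [polydiscKernelOp, Matrix.conjTranspose_apply, Matrix.of_apply, star_smul, this]
    have hid : star (ContinuousLinearMap.id ℂ ℂ) = ContinuousLinearMap.id ℂ ℂ :=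
      star_one (ℂ →L[ℂ] ℂ)
    rw [hid]
  · have h := (RCLike.nonneg_iff.1 (hk.2 v)).1
    convert! h using 2
    refine Finsupp.sum_congr fun z _ => Finsupp.sum_congr fun w _ => ?_
    have := hk.1.apply z w
    simp only [polydiscKernelOp, Matrix.of_apply, FunLike.coe_smul, Pi.smul_apply,
      ContinuousLinearMap.id_apply, smul_eq_mul, RCLike.inner_apply, map_mul]
    rw [← this]
    simp
    ring

instance factPosSemidefPolydiscKernelOp (S : ClassicalSpace) (n : ℕ) :
    Fact (polydiscKernelOp S n).PosSemidef := ⟨posSemidef_polydiscKernelOp S n⟩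

/-- The scalar Hardy, Bergman or Dirichlet space on the polydisc: the reproducing kernel Hilbert
space of functions on `polydisc n` with kernel `polydiscKernel S n`. -/
abbrev PolydiscSpace (S : ClassicalSpace) (n : ℕ) : Type :=
  RKHS.OfKernel (polydiscKernelOp S n)

section Multipliers

variable {H X : Type*} [NormedAddCommGroup H] [InnerProductSpace ℂ H] [RKHS ℂ H X ℂ]

/-- `φ` is a multiplier of the space `H` of functions on `X` if `φ f ∈ H` for all `f ∈ H`. -/
def IsMultiplier (H : Type*) {X : Type*} [NormedAddCommGroup H] [InnerProductSpace ℂ H]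
    [RKHS ℂ H X ℂ] (φ : X → ℂ) : Prop :=
  ∀ f : H, ∃ g : H, ∀ x, g x = φ x * f x

/-- The product `φ f`, as an element of `H`. -/
noncomputable def IsMultiplier.mul {φ : X → ℂ} (hφ : IsMultiplier H φ) (f : H) : H :=
  (hφ f).choose

theorem IsMultiplier.mul_apply {φ : X → ℂ} (hφ : IsMultiplier H φ) (f : H) (x : X) :
    hφ.mul f x = φ x * f x := (hφ f).choose_spec x

/-- Multiplication by a multiplier, as a linear map. -/
noncomputable def IsMultiplier.mulLinearMap {φ : X → ℂ} (hφ : IsMultiplier H φ) : H →ₗ[ℂ] H where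
  toFun f := hφ.mul f
  map_add' f g := by
    ext x
    simp [hφ.mul_apply, mul_add]
  map_smul' c f := by
    ext x
    simp [hφ.mul_apply, mul_left_comm]

theorem IsMultiplier.mulLinearMap_apply {φ : X → ℂ} (hφ : IsMultiplier H φ) (f : H) (x : X) :
    hφ.mulLinearMap f x = φ x * f x := hφ.mul_apply f x

theorem IsMultiplier.continuous_mulLinearMap [CompleteSpace H] {φ : X → ℂ}
    (hφ : IsMultiplier H φ) : Continuous hφ.mulLinearMap := by
  refine LinearMap.continuous_of_seq_closed_graph _ fun u f g hu hg => ?_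
  ext x
  have h1 : Filter.Tendsto (fun m => hφ.mulLinearMap (u m) x) Filter.atTop (𝓝 (g x)) :=
    ((RKHS.continuous_eval (𝕜 := ℂ) x).tendsto g).comp hg
  have h2 : Filter.Tendsto (fun m => φ x * u m x) Filter.atTop (𝓝 (φ x * f x)) :=
    (((RKHS.continuous_eval (𝕜 := ℂ) x).tendsto f).comp hu).const_mul _
  simp only [hφ.mulLinearMap_apply] at h1
  rw [hφ.mulLinearMap_apply]
  exact tendsto_nhds_unique h1 h2

/-- The multiplication operator `M_φ f = φ f` of a multiplier `φ`, bounded by the closed graph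
theorem. -/
noncomputable def IsMultiplier.mulOp [CompleteSpace H] {φ : X → ℂ} (hφ : IsMultiplier H φ) :
    H →L[ℂ] H :=
  ⟨hφ.mulLinearMap, hφ.continuous_mulLinearMap⟩

theorem IsMultiplier.mulOp_apply [CompleteSpace H] {φ : X → ℂ} (hφ : IsMultiplier H φ)
    (f : H) (x : X) : hφ.mulOp f x = φ x * f x := hφ.mulLinearMap_apply f x

end Multipliers

/-- `T` is a pure contraction: `‖T‖ ≤ 1`, and the powers of the adjoint of `T` tend to `0` in the
strong operator topology. -/
def IsPureContraction {H : Type*} [NormedAddCommGroup H] [InnerProductSpace ℂ H] [CompleteSpace H]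
    (T : H →L[ℂ] H) : Prop :=
  ‖T‖ ≤ 1 ∧ ∀ h : H,
    Filter.Tendsto (fun m : ℕ => ‖(ContinuousLinearMap.adjoint T ^ m) h‖) Filter.atTop (𝓝 0)

/-! The kernel functions $k_x$ are eigenvectors of $M_\varphi^*$ with eigenvalue
$\overline{\varphi(x)}$, so $M_\varphi^{*m} k_x = \overline{\varphi(x)}^m k_x$. Applied to $k_0$,
purity forces $|\varphi(0)| < 1$. Conversely, contractivity gives $|\varphi| \le 1$. If
$|\varphi(x)| = 1$, then `apply_eq_smul_of_adjoint_apply_eq` yields $\varphi k_x = \varphi(x) k_x$;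
evaluation at $0$, where $k_x(0) = 1$, gives $\varphi(0) = \varphi(x)$, a contradiction. This
replaces the maximum principle, so no holomorphy is needed. Hence $|\varphi| < 1$ everywhere, the
powers tend to $0$ on each $k_x$, and `tendsto_pow_apply_zero_of_dense_span` extends this to the
whole space. -/

open Filter in
/-- The powers of a contraction tend to `0` strongly as soon as they do so on a set whose linear
span is dense. -/
theorem tendsto_pow_apply_zero_of_dense_span {H : Type*} [NormedAddCommGroup H]
    [NormedSpace ℂ H] {T : H →L[ℂ] H} (hT : ‖T‖ ≤ 1) {s : Set H}
    (hs : (Submodule.span ℂ s).topologicalClosure = ⊤)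
    (h0 : ∀ f ∈ s, Tendsto (fun m : ℕ => (T ^ m) f) atTop (𝓝 0)) (h : H) :
    Tendsto (fun m : ℕ => (T ^ m) h) atTop (𝓝 0) := by
  have hspan : ∀ f ∈ Submodule.span ℂ s, Tendsto (fun m : ℕ => (T ^ m) f) atTop (𝓝 0) := by
    intro f hf
    induction hf using Submodule.span_induction with
    | mem f hf => exact h0 f hf
    | zero => simp
    | add f g _ _ hf hg => simpa using hf.add hg
    | smul c f _ hf => simpa using hf.const_smul c
  have hpow : ∀ (m : ℕ) (f : H), ‖(T ^ m) f‖ ≤ ‖f‖ := by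
    intro m
    induction m with
    | zero => simp
    | succ m ih =>
      intro f
      rw [pow_succ]
      exact (ih (T f)).trans (by simpa using T.le_of_opNorm_le hT f)
  have hmem : h ∈ closure (Submodule.span ℂ s : Set H) := by
    rw [← Submodule.topologicalClosure_coe, hs]
    trivial
  rw [Metric.tendsto_atTop]
  intro ε hε
  -- The error of replacing `h` by `g` stays below `ε / 2` for every `m`, since all powers are
  -- contractions.
  obtain ⟨g, hg, hgd⟩ := Metric.mem_closure_iff.1 hmem (ε / 2) (half_pos hε)
  obtain ⟨N, hN⟩ := Metric.tendsto_atTop.1 (hspan g hg) (ε / 2) (half_pos hε)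
  refine ⟨N, fun m hm => ?_⟩
  have h1 := hN m hm
  have h2 := hpow m (h - g)
  rw [dist_zero_right] at h1 ⊢
  rw [dist_eq_norm] at hgd
  have h3 : (T ^ m) h = (T ^ m) (h - g) + (T ^ m) g := by simp
  rw [h3]
  linarith [norm_add_le ((T ^ m) (h - g)) ((T ^ m) g)]

open InnerProductSpace in
/-- A unimodular eigenvalue of the adjoint of a contraction is, up to conjugation, an eigenvalue of
the contraction, with the same eigenvectors. -/
theorem apply_eq_smul_of_adjoint_apply_eq {H : Type*} [NormedAddCommGroup H]
    [InnerProductSpace ℂ H] [CompleteSpace H] {T : H →L[ℂ] H} (hT : ‖T‖ ≤ 1) {c : ℂ}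
    (hc : ‖c‖ = 1) {k : H} (hk : ContinuousLinearMap.adjoint T k = conj c • k) :
    T k = c • k := by
  -- With this value, $\|Tk - ck\|^2 = \|Tk\|^2 - 2\|k\|^2 + \|k\|^2 \le 0$.
  have h1 : ⟪T k, c • k⟫_ℂ = ((‖k‖ ^ 2 : ℝ) : ℂ) := by
    rw [← ContinuousLinearMap.adjoint_inner_right, map_smul, hk, smul_smul, inner_smul_right,
      Complex.mul_conj, Complex.normSq_eq_norm_sq, hc, inner_self_eq_norm_sq_to_K]
    simp
  have h2 := norm_sub_sq (𝕜 := ℂ) (T k) (c • k)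
  rw [h1, norm_smul, hc, one_mul] at h2
  have h3 : ‖T k‖ ≤ ‖k‖ := by simpa using T.le_of_opNorm_le hT k
  have h4 : ‖T k‖ ^ 2 ≤ ‖k‖ ^ 2 := by gcongr
  simp only [RCLike.re_to_complex, Complex.ofReal_re] at h2
  have h5 : ‖T k - c • k‖ ^ 2 = 0 := le_antisymm (by linarith) (sq_nonneg _)
  exact sub_eq_zero.1 (norm_eq_zero.1 (pow_eq_zero_iff two_ne_zero |>.1 h5))

section Multipliers

variable {H X : Type*} [NormedAddCommGroup H] [InnerProductSpace ℂ H] [RKHS ℂ H X ℂ]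
  [CompleteSpace H]

-- By the reproducing property, pairing either side with `f` evaluates `φ f` at `x`.
open InnerProductSpace in
theorem IsMultiplier.adjoint_mulOp_kerFun {φ : X → ℂ} (hφ : IsMultiplier H φ) (x : X) (v : ℂ) :
    ContinuousLinearMap.adjoint hφ.mulOp (RKHS.kerFun H x v) =
      conj (φ x) • RKHS.kerFun H x v := by
  refine ext_inner_right ℂ fun f => ?_
  rw [ContinuousLinearMap.adjoint_inner_left, RKHS.kerFun_inner, inner_smul_left,
    RKHS.kerFun_inner, hφ.mulOp_apply]
  simp [mul_assoc]

theorem IsMultiplier.adjoint_mulOp_pow_kerFun {φ : X → ℂ} (hφ : IsMultiplier H φ) (x : X) (v : ℂ)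
    (m : ℕ) :
    (ContinuousLinearMap.adjoint hφ.mulOp ^ m) (RKHS.kerFun H x v) =
      conj (φ x) ^ m • RKHS.kerFun H x v := by
  induction m with
  | zero => simp
  | succ m ih =>
    rw [pow_succ', mul_apply_eq_comp, ih, map_smul, hφ.adjoint_mulOp_kerFun, smul_smul,
      pow_succ]

open Filter in
/-- If some point `x₀` is such that no kernel function vanishes there, then a contractive
multiplication operator is a pure contraction if and only if its symbol has modulus less than `1`
at `x₀`. -/
theorem IsMultiplier.isPureContraction_iff {φ : X → ℂ} (hφ : IsMultiplier H φ)
    (hcontr : ‖hφ.mulOp‖ ≤ 1) {x₀ : X} (hx₀ : ∀ x, RKHS.kernel H x₀ x 1 ≠ 0) :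
    IsPureContraction hφ.mulOp ↔ ‖φ x₀‖ < 1 := by
  have hk : ∀ x, RKHS.kerFun H x (1 : ℂ) x₀ ≠ 0 := fun x => by
    rw [RKHS.kerFun_apply]
    exact hx₀ x
  have hne : ∀ x, RKHS.kerFun H x (1 : ℂ) ≠ 0 := fun x h => hk x (by rw [h]; simp)
  have hadj : ‖ContinuousLinearMap.adjoint hφ.mulOp‖ ≤ 1 := by
    rwa [LinearIsometryEquiv.norm_map]
  constructor
  · rintro ⟨-, h⟩
    have h1 := (h (RKHS.kerFun H x₀ (1 : ℂ))).mul_const ‖RKHS.kerFun H x₀ (1 : ℂ)‖⁻¹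
    have h2 : ‖RKHS.kerFun H x₀ (1 : ℂ)‖ ≠ 0 := norm_ne_zero_iff.2 (hne x₀)
    simp only [hφ.adjoint_mulOp_pow_kerFun, norm_smul, norm_pow, RCLike.norm_conj, zero_mul,
      mul_inv_cancel_right₀ h2] at h1
    simpa using tendsto_pow_atTop_nhds_zero_iff.1 h1
  · intro h0
    refine ⟨hcontr, fun h => ?_⟩
    have hlt : ∀ x, ‖φ x‖ < 1 := by
      intro x
      refine lt_of_le_of_ne ?_ fun h1 => ?_
      · have h1 := ContinuousLinearMap.le_of_opNorm_le _ hadj (RKHS.kerFun H x (1 : ℂ))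
        rw [hφ.adjoint_mulOp_kerFun, norm_smul, RCLike.norm_conj] at h1
        exact le_of_mul_le_mul_right h1 (norm_pos_iff.2 (hne x))
      -- At `x₀` the identity $\varphi k_x = \varphi(x) k_x$ can be cancelled by $k_x(x_0) \ne 0$.
      · have h2 := apply_eq_smul_of_adjoint_apply_eq hcontr h1 (hφ.adjoint_mulOp_kerFun x 1)
        have h3 := DFunLike.congr_fun h2 x₀
        rw [hφ.mulOp_apply, RKHS.coe_smul, Pi.smul_apply, smul_eq_mul] at h3
        rw [mul_right_cancel₀ (hk x) h3] at h0
        exact h0.ne h1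
    rw [← tendsto_zero_iff_norm_tendsto_zero]
    refine tendsto_pow_apply_zero_of_dense_span hadj (RKHS.kerFun_dense H) ?_ h
    rintro _ ⟨x, v, rfl⟩
    simp only [hφ.adjoint_mulOp_pow_kerFun]
    have h1 : Tendsto (fun m : ℕ => conj (φ x) ^ m) atTop (𝓝 0) :=
      tendsto_pow_atTop_nhds_zero_of_norm_lt_one (by rw [RCLike.norm_conj]; exact hlt x)
    simpa using h1.smul_const (RKHS.kerFun H x v)

end Multipliers

/-- Every factor is `discKernelFun S 0 = 1`, so the origin can serve as `x₀`. -/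
theorem polydiscKernel_zero_left (S : ClassicalSpace) (n : ℕ) (z : polydisc n) :
    polydiscKernel S n (polydiscZero n) z = 1 := by
  cases S <;> simp [polydiscKernel, polydiscZero, discKernelFun]

theorem theorem3p8 (S : ClassicalSpace) (n : ℕ) (hn : 1 ≤ n) (φ : polydisc n → ℂ)
    (hφ : IsMultiplier (PolydiscSpace S n) φ) (hcontr : ‖hφ.mulOp‖ ≤ 1) :
    IsPureContraction hφ.mulOp ↔ ‖φ (polydiscZero n)‖ < 1 := by
  refine hφ.isPureContraction_iff hcontr fun z => ?_
  rw [RKHS.OfKernel.kernel_ofKernel]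
  simp [polydiscKernelOp, polydiscKernel_zero_left]
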